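/- For a $2\times 2$ complex matrix $A=(a_{ij})$ let $\|A\|$ be its operator norm with respect to the Euclidean norm on $\mathbb C^2$, and let $$\mathbb F=\{(a_{11},\,a_{22},\,\det A,\,a_{12}+a_{21})\in\mathbb C^4 : A=(a_{ij})\in M_2(\mathbb C),\ \|A\|<1\},$$ a bounded domain in $\mathbb C^4$. The Shilov boundary $\partial_s\mathbb F$ is the smallest closed subset $K$ of $\overline{\mathbb F}$ such that every function that is continuous on $\overline{\mathbb F}$ and holomorphic in $\mathbb F$ attains its maximum modulus over $\overline{\mathbb F}$ at a point of $K$. Let $\mathbb T=\{\zeta\in\mathbb C:|\zeta|=1\}$, let $E_3=\{y\in\mathbb R^3: y_1^2+y_2^2+y_3^2\le 1\}$, and let $\sim$ be the equivalence relation on $\mathbb T\times E_3$ given by $(\zeta,y)\sim(\eta,z)$ if and only if $g(\zeta,y)=g(\eta,z)$, where $$g(\zeta,y)=\bigl(\zeta(y_2+iy_3),\ -\zeta(y_2-iy_3),\ -\zeta^2,\ 2\zeta y_1\bigr).$$ Then the smallest set $\partial_s\mathbb F$ exists; the relation $\sim$ is the antipodal identification, that is, $(\zeta,y)\sim(\eta,z)$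 if and only if $(\zeta,y)=(\eta,z)$ or $(\zeta,y)=(-\eta,-z)$; and $\partial_s\mathbb F$ (with the subspace topology of $\mathbb C^4$) is homeomorphic to the quotient space $(\mathbb T\times E_3)/\!\sim$. -/

import Mathlib

/-- `K` is a closed subset of the closure of `Ω` on which every function that is continuous on the
closure of `Ω` and holomorphic in `Ω` attains its maximum modulus (over the closure of `Ω`). -/
def IsClosedBoundary {V : Type*} [NormedAddCommGroup V] [NormedSpace ℂ V]
    (Ω K : Set V) : Prop :=
  IsClosed K ∧ K ⊆ closure Ω ∧
    ∀ f : V → ℂ, DiffContOnCl ℂ f Ω → ∃ x ∈ K, ∀ y ∈ closure Ω, ‖f y‖ ≤ ‖f x‖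

/-- The Shilov (distinguished) boundary of a bounded domain `Ω`: the smallest `K` with
`IsClosedBoundary Ω K`. As a set it is the intersection of all of them; that the intersection
is itself such a `K` is the assertion `IsLeast {K | IsClosedBoundary Ω K} (shilovBoundary Ω)`. -/
def shilovBoundary {V : Type*} [NormedAddCommGroup V] [NormedSpace ℂ V]
    (Ω : Set V) : Set V :=
  ⋂₀ {K | IsClosedBoundary Ω K}

/-- The map `A ↦ (a₁₁, a₂₂, det A, a₁₂ + a₂₁)`. -/
def piF (A : Matrix (Fin 2) (Fin 2) ℂ) : Fin 4 → ℂ :=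
  ![A 0 0, A 1 1, A.det, A 0 1 + A 1 0]

/-- The domain `𝔽`, the image under `piF` of the open unit ball of `M₂(ℂ)` for the operator norm
induced by the Euclidean norm on `ℂ²`. -/
def domainF : Set (Fin 4 → ℂ) :=
  piF '' {A | ‖Matrix.toEuclideanCLM (n := Fin 2) (𝕜 := ℂ) A‖ < 1}

/-- The closed unit ball `E₃` of Euclidean `ℝ³`. -/
abbrev E3 : Type := Metric.closedBall (0 : EuclideanSpace ℝ (Fin 3)) 1

/-- The map `g(ζ, y) = (ζ(y₂ + i y₃), -ζ(y₂ - i y₃), -ζ², 2 ζ y₁)` on `𝕋 × E₃`. -/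
noncomputable def gMap (u : Circle × E3) : Fin 4 → ℂ :=
  ![(u.1 : ℂ) * ((u.2.1 1 : ℂ) + Complex.I * (u.2.1 2 : ℂ)),
    -(u.1 : ℂ) * ((u.2.1 1 : ℂ) - Complex.I * (u.2.1 2 : ℂ)),
    -(u.1 : ℂ) ^ 2,
    2 * (u.1 : ℂ) * (u.2.1 0 : ℂ)]

/-- The equivalence relation `u ∼ v ↔ g u = g v` on `𝕋 × E₃`. -/
noncomputable def gSetoid : Setoid (Circle × E3) := Setoid.ker gMap

/-! The smallest boundary is the image of the unitary group U(2) under `piF`, and this image is the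
range of `gMap`. It is a boundary: by `closure_domainF`, closure points are `piF A` with `A` a
contraction. A unitary change of basis makes the columns of `A` orthogonal; letting the length and
phase of each column in turn run over the unit disc, the maximum principle pushes `A` to a unitary
without decreasing `‖f‖` (`exists_unitary_norm_le`). It is minimal: a unitary `W` is a peak point of
the ball for an affine function, but `piF` cannot tell `A` from its transpose. The sum of the `n`-th
powers of the two peak values is a polynomial in `piF A`; for large `n` it is uniformly small on a
closed set missing `piF W`, but not at `piF W` (`piF_mem_of_isClosedBoundary`). The topology follows
since `gMap` is continuous on a compact space and its fibres are antipodal pairs. -/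

/-! ### Contractions and unitaries of size two -/

/-- The Euclidean operator norm of a complex `2 × 2` matrix is at most one. -/
def IsContractionMatrix (A : Matrix (Fin 2) (Fin 2) ℂ) : Prop :=
  ‖Matrix.toEuclideanCLM (n := Fin 2) (𝕜 := ℂ) A‖ ≤ 1

lemma IsContractionMatrix.mul {A B : Matrix (Fin 2) (Fin 2) ℂ} (hA : IsContractionMatrix A)
    (hB : IsContractionMatrix B) : IsContractionMatrix (A * B) := by
  unfold IsContractionMatrix at *
  rw [map_mul]
  exact (norm_mul_le _ _).trans (mul_le_one₀ hA (norm_nonneg _) hB)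

lemma isContractionMatrix_iff (A : Matrix (Fin 2) (Fin 2) ℂ) :
    IsContractionMatrix A ↔ ∀ a b : ℂ,
      ‖A 0 0 * a + A 0 1 * b‖ ^ 2 + ‖A 1 0 * a + A 1 1 * b‖ ^ 2 ≤ ‖a‖ ^ 2 + ‖b‖ ^ 2 := by
  have key : ∀ v : EuclideanSpace ℂ (Fin 2),
      ‖Matrix.toEuclideanCLM (n := Fin 2) (𝕜 := ℂ) A v‖ ^ 2 =
        ‖A 0 0 * v 0 + A 0 1 * v 1‖ ^ 2 + ‖A 1 0 * v 0 + A 1 1 * v 1‖ ^ 2 := by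
    intro v
    rw [EuclideanSpace.norm_sq_eq, Fin.sum_univ_two]
    simp [Matrix.ofLp_toEuclideanCLM, Matrix.mulVec, dotProduct, Fin.sum_univ_two]
  constructor
  · intro h a b
    have h1 := key !₂[a, b]
    have h2 := (Matrix.toEuclideanCLM (n := Fin 2) (𝕜 := ℂ) A).le_of_opNorm_le h !₂[a, b]
    have h3 : ‖(!₂[a, b] : EuclideanSpace ℂ (Fin 2))‖ ^ 2 = ‖a‖ ^ 2 + ‖b‖ ^ 2 := by
      rw [EuclideanSpace.norm_sq_eq, Fin.sum_univ_two]; simp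
    rw [one_mul] at h2
    have h4 := pow_le_pow_left₀ (norm_nonneg _) h2 2
    rw [h1, h3] at h4
    simpa using h4
  · intro h
    refine ContinuousLinearMap.opNorm_le_bound _ zero_le_one fun v => ?_
    rw [one_mul]
    refine le_of_sq_le_sq ?_ (norm_nonneg _)
    rw [key, EuclideanSpace.norm_sq_eq, Fin.sum_univ_two]
    exact h _ _

lemma IsContractionMatrix.col_zero {A : Matrix (Fin 2) (Fin 2) ℂ} (hA : IsContractionMatrix A) :
    ‖A 0 0‖ ^ 2 + ‖A 1 0‖ ^ 2 ≤ 1 := by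
  simpa using (isContractionMatrix_iff A).1 hA 1 0

lemma IsContractionMatrix.col_one {A : Matrix (Fin 2) (Fin 2) ℂ} (hA : IsContractionMatrix A) :
    ‖A 0 1‖ ^ 2 + ‖A 1 1‖ ^ 2 ≤ 1 := by
  simpa using (isContractionMatrix_iff A).1 hA 0 1

/-- Pythagoras: orthogonality kills the cross term in the squared norm of a combination of the
columns. -/
lemma isContractionMatrix_of_orthogonal_columns {p q r s : ℂ}
    (h : star p * q + star r * s = 0) (h₁ : ‖p‖ ^ 2 + ‖r‖ ^ 2 ≤ 1) (h₂ : ‖q‖ ^ 2 + ‖s‖ ^ 2 ≤ 1) :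
    IsContractionMatrix !![p, q; r, s] := by
  rw [isContractionMatrix_iff]
  intro a b
  have hre := congrArg Complex.re h
  have him := congrArg Complex.im h
  have e : ‖p * a + q * b‖ ^ 2 + ‖r * a + s * b‖ ^ 2 =
      ‖a‖ ^ 2 * (‖p‖ ^ 2 + ‖r‖ ^ 2) + ‖b‖ ^ 2 * (‖q‖ ^ 2 + ‖s‖ ^ 2) := by
    simp only [Complex.sq_norm, Complex.normSq_apply, Complex.add_re, Complex.add_im,
      Complex.mul_re, Complex.mul_im, Complex.star_def, Complex.conj_re, Complex.conj_im,
      Complex.zero_re, Complex.zero_im] at *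
    linear_combination 2 * (a.re * b.re + a.im * b.im) * hre
      - 2 * (a.re * b.im - a.im * b.re) * him
  simp only [Matrix.of_apply, Matrix.cons_val', Matrix.cons_val_zero, Matrix.cons_val_one,
    Matrix.cons_val_fin_one]
  rw [e]
  nlinarith [mul_le_mul_of_nonneg_left h₁ (sq_nonneg ‖a‖),
    mul_le_mul_of_nonneg_left h₂ (sq_nonneg ‖b‖)]

lemma star_mul_self_re (z : ℂ) : star z * z = ((‖z‖ ^ 2 : ℝ) : ℂ) := by
  rw [Complex.star_def, mul_comm, Complex.mul_conj, Complex.normSq_eq_norm_sq]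

lemma mem_unitaryGroup_two_iff (p q r s : ℂ) :
    !![p, q; r, s] ∈ Matrix.unitaryGroup (Fin 2) ℂ ↔
      star p * q + star r * s = 0 ∧ ‖p‖ ^ 2 + ‖r‖ ^ 2 = 1 ∧ ‖q‖ ^ 2 + ‖s‖ ^ 2 = 1 := by
  rw [Matrix.mem_unitaryGroup_iff', ← Matrix.ext_iff]
  simp only [Matrix.star_eq_conjTranspose, Fin.forall_fin_two, Matrix.mul_apply,
    Fin.sum_univ_two, Matrix.conjTranspose_apply, Matrix.of_apply, Matrix.cons_val',
    Matrix.cons_val_zero, Matrix.cons_val_one, Matrix.cons_val_fin_one, star_mul_self_re,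
    Matrix.one_apply_eq, ne_eq, zero_ne_one, one_ne_zero, not_false_eq_true, Matrix.one_apply_ne]
  norm_cast
  constructor
  · rintro ⟨⟨h1, h2⟩, h3, h4⟩
    exact ⟨h2, h1, h4⟩
  · rintro ⟨h1, h2, h3⟩
    refine ⟨⟨h2, h1⟩, ?_, h3⟩
    have := congrArg star h1
    simpa [mul_comm] using this

lemma isContractionMatrix_of_mem_unitaryGroup {U : Matrix (Fin 2) (Fin 2) ℂ}
    (hU : U ∈ Matrix.unitaryGroup (Fin 2) ℂ) : IsContractionMatrix U := by
  rw [U.eta_fin_two] at hU ⊢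
  obtain ⟨h, h1, h2⟩ := (mem_unitaryGroup_two_iff _ _ _ _).1 hU
  exact isContractionMatrix_of_orthogonal_columns h h1.le h2.le

lemma isCompact_setOf_isContractionMatrix : IsCompact {A | IsContractionMatrix A} := by
  let T := (Matrix.toEuclideanCLM (n := Fin 2) (𝕜 := ℂ)).toAlgEquiv.toLinearEquiv
  have hc : Continuous T.symm := T.symm.toLinearMap.continuous_of_finiteDimensional
  convert! (isCompact_closedBall (0 : EuclideanSpace ℂ (Fin 2) →L[ℂ] _) 1).image hc using 1
  ext A
  constructor
  · intro hA
    exact ⟨T A, mem_closedBall_zero_iff.2 hA, T.symm_apply_apply A⟩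
  · rintro ⟨B, hB, rfl⟩
    have : T (T.symm B) = B := T.apply_symm_apply B
    change ‖T (T.symm B)‖ ≤ 1
    rw [this]; simpa using hB

/-! ### The closed domain and the maximum principle -/

lemma continuous_piF : Continuous piF := by
  unfold piF
  refine continuous_pi fun i => ?_
  fin_cases i <;> simp [Matrix.det_fin_two] <;> fun_prop

lemma piF_smul_mem_domainF {A : Matrix (Fin 2) (Fin 2) ℂ} (hA : IsContractionMatrix A) {r : ℝ}
    (h0 : 0 ≤ r) (h1 : r < 1) : piF ((r : ℂ) • A) ∈ domainF := by
  refine ⟨_, ?_, rfl⟩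
  unfold IsContractionMatrix at hA
  simp only [Set.mem_ofPred_eq, map_smul, norm_smul, Complex.norm_real, Real.norm_of_nonneg h0]
  nlinarith

lemma closure_domainF : closure domainF = piF '' {A | IsContractionMatrix A} := by
  refine subset_antisymm ?_ ?_
  · refine closure_minimal ?_ (isCompact_setOf_isContractionMatrix.image continuous_piF).isClosed
    refine Set.image_mono fun A hA => ?_
    exact le_of_lt (Set.mem_ofPred.1 hA)
  · rintro _ ⟨A, hA, rfl⟩
    have hc : Filter.Tendsto (fun r : ℝ => piF ((r : ℂ) • A)) (nhdsWithin 1 (Set.Ioo 0 1))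
        (nhds (piF A)) := by
      have : Continuous fun r : ℝ => piF ((r : ℂ) • A) := continuous_piF.comp (by fun_prop)
      simpa using (this.tendsto 1).mono_left nhdsWithin_le_nhds
    have : (nhdsWithin (1 : ℝ) (Set.Ioo 0 1)).NeBot := by
      rw [← mem_closure_iff_nhdsWithin_neBot, closure_Ioo zero_ne_one]; simp
    exact mem_closure_of_tendsto hc (eventually_mem_nhdsWithin.mono fun r hr =>
      piF_smul_mem_domainF hA hr.1.le hr.2)

/-- The maximum principle along an affine disc of contractions, which may touch the boundary
of the unit ball. -/
lemma exists_norm_le_on_circle {f : (Fin 4 → ℂ) → ℂ} (hf : DiffContOnCl ℂ f domainF)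
    {P Q : Matrix (Fin 2) (Fin 2) ℂ} (hPQ : ∀ z : ℂ, ‖z‖ ≤ 1 → IsContractionMatrix (z • P + Q)) :
    ∃ z : ℂ, ‖z‖ = 1 ∧ ∀ w : ℂ, ‖w‖ ≤ 1 → ‖f (piF (w • P + Q))‖ ≤ ‖f (piF (z • P + Q))‖ := by
  -- On the disc itself `f` may be merely continuous. Scaling by `r < 1` moves the disc into the
  -- domain; maximizers on the circle then subconverge as `r → 1`.
  let γ : ℝ × ℂ → (Fin 4 → ℂ) := fun p => piF ((p.1 : ℂ) • (p.2 • P + Q))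
  have hγ : Continuous γ := continuous_piF.comp (by fun_prop)
  have hmaps : Set.MapsTo γ (Set.Icc 0 1 ×ˢ Metric.closedBall 0 1) (closure domainF) := by
    rintro ⟨r, z⟩ ⟨hr, hz⟩
    have hA := hPQ z (by simpa using hz)
    rcases hr.2.lt_or_eq with h | h
    · exact subset_closure (piF_smul_mem_domainF hA hr.1 h)
    · rw [closure_domainF]
      refine ⟨_, hA, ?_⟩
      simp only at h
      simp [γ, h]
  have hcont : ContinuousOn (fun p => ‖f (γ p)‖) (Set.Icc 0 1 ×ˢ Metric.closedBall 0 1) :=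
    (hf.continuousOn.comp hγ.continuousOn hmaps).norm
  have hdisc : ∀ r ∈ Set.Ico (0 : ℝ) 1, ∃ z ∈ Metric.sphere (0 : ℂ) 1,
      ∀ w ∈ Metric.closedBall (0 : ℂ) 1, ‖f (γ (r, w))‖ ≤ ‖f (γ (r, z))‖ := by
    intro r hr
    have hd : DiffContOnCl ℂ (fun w => f (γ (r, w))) (Metric.ball 0 1) := by
      have hγd : Differentiable ℂ fun w => γ (r, w) := by
        refine differentiable_pi.2 fun i => ?_
        fin_cases i <;> simp [γ, piF, Matrix.det_fin_two] <;> fun_prop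
      refine DifferentiableOn.diffContOnCl ?_
      refine hf.differentiableOn.comp hγd.differentiableOn ?_
      intro w hw
      rw [closure_ball _ one_ne_zero] at hw
      exact piF_smul_mem_domainF (hPQ w (by simpa using hw)) hr.1 hr.2
    obtain ⟨z, hz, hmax⟩ := Complex.exists_mem_frontier_isMaxOn_norm Metric.isBounded_ball
      (Metric.nonempty_ball.2 one_pos) hd
    rw [frontier_ball _ one_ne_zero] at hz
    rw [closure_ball _ one_ne_zero] at hmax
    exact ⟨z, hz, fun w hw => hmax hw⟩
  let r : ℕ → ℝ := fun n => 1 - 1 / ((n : ℝ) + 1)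
  have hr : ∀ n, r n ∈ Set.Ico (0 : ℝ) 1 := by
    intro n
    have h1 : 0 < 1 / ((n : ℝ) + 1) := by positivity
    have h2 : 1 / ((n : ℝ) + 1) ≤ 1 := by
      rw [div_le_one (by positivity)]; linarith [n.cast_nonneg (α := ℝ)]
    exact ⟨by simp only [r]; linarith, by simp only [r]; linarith⟩
  have hr1 : Filter.Tendsto r Filter.atTop (nhds 1) := by
    simpa [r] using tendsto_one_div_add_atTop_nhds_zero_nat.const_sub (1 : ℝ)
  choose z hz hmax using fun n => hdisc (r n) (hr n)
  obtain ⟨z₀, hz₀, φ, hφ, hlim⟩ := (isCompact_sphere (0 : ℂ) 1).tendsto_subseq hz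
  have hrφ := hr1.comp hφ.tendsto_atTop
  have hlimits : ∀ (u : ℕ → ℂ) (u₀ : ℂ), (∀ n, u n ∈ Metric.closedBall (0 : ℂ) 1) →
      u₀ ∈ Metric.closedBall (0 : ℂ) 1 → Filter.Tendsto u Filter.atTop (nhds u₀) →
      Filter.Tendsto (fun n => ‖f (γ (r (φ n), u n))‖) Filter.atTop
        (nhds ‖f (γ (1, u₀))‖) := by
    intro u u₀ hu hu₀ hlim
    refine (hcont (1, u₀) ⟨by simp, hu₀⟩).tendsto.comp
      (tendsto_nhdsWithin_iff.2 ⟨hrφ.prodMk_nhds hlim, .of_forall fun n => ?_⟩)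
    exact ⟨Set.Ico_subset_Icc_self (hr _), hu n⟩
  refine ⟨z₀, by simpa using hz₀, fun w hw => ?_⟩
  have hw' : w ∈ Metric.closedBall (0 : ℂ) 1 := by simpa using hw
  have := le_of_tendsto_of_tendsto'
    (hlimits (fun _ => w) w (fun _ => hw') hw' tendsto_const_nhds)
    (hlimits (z ∘ φ) z₀ (fun n => Metric.sphere_subset_closedBall (hz _))
      (Metric.sphere_subset_closedBall hz₀) hlim)
    (fun n => hmax _ w hw')
  simpa [γ] using this

/-- Writes a column as a point `k` of the disc spanned by a unit vector that stays orthogonal to the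
other column, even if the column is zero. -/
lemma exists_unit_vector_of_orthogonal {p q r s : ℂ} (h : star p * q + star r * s = 0)
    (h₁ : ‖p‖ ^ 2 + ‖r‖ ^ 2 ≤ 1) :
    ∃ u v k : ℂ, ‖u‖ ^ 2 + ‖v‖ ^ 2 = 1 ∧ star u * q + star v * s = 0 ∧ ‖k‖ ≤ 1 ∧
      p = k * u ∧ r = k * v := by
  have unit : ∀ a b : ℂ, ‖a‖ ^ 2 + ‖b‖ ^ 2 ≠ 0 →
      ∃ k : ℝ, k ≠ 0 ∧ k ^ 2 = ‖a‖ ^ 2 + ‖b‖ ^ 2 ∧ ‖a / k‖ ^ 2 + ‖b / k‖ ^ 2 = 1 := by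
    intro a b hab
    refine ⟨√(‖a‖ ^ 2 + ‖b‖ ^ 2), (Real.sqrt_ne_zero (by positivity)).2 hab,
      Real.sq_sqrt (by positivity), ?_⟩
    simp only [norm_div, Complex.norm_real, div_pow, Real.norm_eq_abs, sq_abs]
    rw [Real.sq_sqrt (by positivity), ← add_div, div_self hab]
  have pos : ∀ a b : ℂ, ‖a‖ ^ 2 + ‖b‖ ^ 2 = 0 → a = 0 ∧ b = 0 := by
    intro a b hab
    constructor <;> rw [← norm_eq_zero] <;> nlinarith [sq_nonneg ‖a‖, sq_nonneg ‖b‖]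
  by_cases h0 : ‖p‖ ^ 2 + ‖r‖ ^ 2 = 0
  · obtain ⟨rfl, rfl⟩ := pos _ _ h0
    by_cases h2 : ‖q‖ ^ 2 + ‖s‖ ^ 2 = 0
    · obtain ⟨rfl, rfl⟩ := pos _ _ h2
      exact ⟨1, 0, 0, by simp⟩
    · obtain ⟨k, hk, -, hk1⟩ := unit q s h2
      refine ⟨-star s / k, star q / k, 0, ?_, ?_, by simp, by simp, by simp⟩
      · rw [← hk1, neg_div, norm_neg, norm_div, norm_div, norm_star, norm_star, norm_div,
          norm_div, add_comm]
      · simp; ring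
  · obtain ⟨k, hk, hk2, hk1⟩ := unit p r h0
    have hk' : (k : ℂ) ≠ 0 := by exact_mod_cast hk
    refine ⟨p / k, r / k, k, hk1, ?_, ?_, by field_simp, by field_simp⟩
    · rw [star_div₀, star_div₀, div_mul_eq_mul_div, div_mul_eq_mul_div, ← add_div]
      simp only [Complex.star_def, Complex.conj_ofReal] at *
      rw [h, zero_div]
    · rw [Complex.norm_real, Real.norm_eq_abs, ← sq_le_one_iff_abs_le_one, hk2]
      exact h₁

/-- Every contraction becomes a matrix with orthogonal columns after a unitary change of basis. -/
lemma exists_unitary_orthogonal_columns (A : Matrix (Fin 2) (Fin 2) ℂ) :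
    ∃ V ∈ Matrix.unitaryGroup (Fin 2) ℂ,
      star ((A * V) 0 0) * (A * V) 0 1 + star ((A * V) 1 0) * (A * V) 1 1 = 0 := by
  have hH := Matrix.isHermitian_conjTranspose_mul_self A
  -- An eigenbasis of `A* A` makes `(A V)* (A V)` diagonal.
  refine ⟨hH.eigenvectorUnitary, hH.eigenvectorUnitary.2, ?_⟩
  have h := congrFun (congrFun hH.conjStarAlgAut_star_eigenvectorUnitary 0) 1
  rw [Unitary.conjStarAlgAut_star_apply, Matrix.diagonal_apply_ne _ zero_ne_one] at h
  have e : star (hH.eigenvectorUnitary : Matrix (Fin 2) (Fin 2) ℂ) * (A.conjTranspose * A) *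
      hH.eigenvectorUnitary = (A * hH.eigenvectorUnitary).conjTranspose *
        (A * hH.eigenvectorUnitary) := by
    rw [Matrix.conjTranspose_mul, Matrix.star_eq_conjTranspose]
    simp only [Matrix.mul_assoc]
  rw [e, Matrix.mul_apply, Fin.sum_univ_two] at h
  simpa only [Matrix.conjTranspose_apply] using h

/-- Every value of a function on the closed domain is dominated at the image of a unitary. -/
lemma exists_unitary_norm_le {f : (Fin 4 → ℂ) → ℂ} (hf : DiffContOnCl ℂ f domainF)
    {A : Matrix (Fin 2) (Fin 2) ℂ} (hA : IsContractionMatrix A) :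
    ∃ U ∈ Matrix.unitaryGroup (Fin 2) ℂ, ‖f (piF A)‖ ≤ ‖f (piF U)‖ := by
  obtain ⟨V, hV, horth⟩ := exists_unitary_orthogonal_columns A
  have hVs : star V ∈ Matrix.unitaryGroup (Fin 2) ℂ := Unitary.star_mem hV
  have hVc := isContractionMatrix_of_mem_unitaryGroup hVs
  have hAV := hA.mul (isContractionMatrix_of_mem_unitaryGroup hV)
  have hAe : A = (A * V) * star V := by
    rw [Matrix.mul_assoc, Matrix.mem_unitaryGroup_iff.1 hV, Matrix.mul_one]
  rw [(A * V).eta_fin_two] at hAe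
  have hc0 := hAV.col_zero
  have hc1 := hAV.col_one
  generalize (A * V) 0 0 = p at *
  generalize (A * V) 0 1 = q at *
  generalize (A * V) 1 0 = r at *
  generalize (A * V) 1 1 = s at *
  obtain ⟨u, v, k, hu, huo, hk, rfl, rfl⟩ := exists_unit_vector_of_orthogonal horth hc0
  have hrot : ∀ {x y : ℂ} (z : ℂ), star u * x + star v * y = 0 →
      star (z * u) * x + star (z * v) * y = 0 := by
    intro x y z h
    rw [star_mul', star_mul']
    linear_combination star z * h
  have hrotn : ∀ {a b z : ℂ}, ‖a‖ ^ 2 + ‖b‖ ^ 2 = 1 →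
      ‖z * a‖ ^ 2 + ‖z * b‖ ^ 2 = ‖z‖ ^ 2 := by
    intro a b z h
    rw [norm_mul, norm_mul, mul_pow, mul_pow, ← mul_add, h, mul_one]
  have e1 : ∀ z : ℂ, z • (!![u, 0; v, 0] * star V) + !![0, q; 0, s] * star V =
      !![z * u, q; z * v, s] * star V := by
    intro z
    rw [← Matrix.smul_mul, ← Matrix.add_mul]
    simp
  -- The first column moves along its disc; the original matrix is the parameter `k`. The second
  -- column is treated likewise below.
  obtain ⟨z, hz, hmax⟩ := exists_norm_le_on_circle hf (P := !![u, 0; v, 0] * star V)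
    (Q := !![0, q; 0, s] * star V) (by
      intro z hz
      rw [e1]
      refine IsContractionMatrix.mul (isContractionMatrix_of_orthogonal_columns (hrot z huo) ?_
        hc1) hVc
      rw [hrotn hu]
      exact pow_le_one₀ (norm_nonneg _) hz)
  have hz1 := hmax k hk
  rw [e1, e1, ← hAe] at hz1
  have hu' : ‖z * u‖ ^ 2 + ‖z * v‖ ^ 2 = 1 := by rw [hrotn hu, hz, one_pow]
  have huo' : star q * (z * u) + star s * (z * v) = 0 := by
    simpa [mul_comm] using congrArg star (hrot z huo)
  generalize z * u = a at *
  generalize z * v = b at *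
  obtain ⟨c, d, l, hcd, hcdo, hl, rfl, rfl⟩ := exists_unit_vector_of_orthogonal huo' hc1
  have hrot2 : ∀ w : ℂ, star a * (w * c) + star b * (w * d) = 0 := by
    intro w
    have := congrArg star hcdo
    simp only [star_add, star_mul', star_star, star_zero] at this
    linear_combination w * this
  have e2 : ∀ w : ℂ, w • (!![0, c; 0, d] * star V) + !![a, 0; b, 0] * star V =
      !![a, w * c; b, w * d] * star V := by
    intro w
    rw [← Matrix.smul_mul, ← Matrix.add_mul]
    simp
  obtain ⟨w, hw, hmax2⟩ := exists_norm_le_on_circle hf (P := !![0, c; 0, d] * star V)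
    (Q := !![a, 0; b, 0] * star V) (by
      intro w hw
      rw [e2]
      refine IsContractionMatrix.mul (isContractionMatrix_of_orthogonal_columns (hrot2 w) hu'.le
        ?_) hVc
      rw [hrotn hcd]
      exact pow_le_one₀ (norm_nonneg _) hw)
  have hw1 := hmax2 l hl
  rw [e2, e2] at hw1
  refine ⟨!![a, w * c; b, w * d] * star V, mul_mem ?_ hVs, hz1.trans hw1⟩
  rw [mem_unitaryGroup_two_iff]
  exact ⟨hrot2 w, hu', by rw [hrotn hcd, hw, one_pow]⟩

/-! ### Unitary images as the range of `gMap` -/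

lemma continuous_gMap : Continuous gMap := by
  unfold gMap
  refine continuous_pi fun i => ?_
  fin_cases i <;> simp <;> fun_prop

lemma norm_sq_E3 (y : EuclideanSpace ℝ (Fin 3)) : ‖y‖ ^ 2 = y 0 ^ 2 + y 1 ^ 2 + y 2 ^ 2 := by
  rw [EuclideanSpace.norm_sq_eq, Fin.sum_univ_three]
  simp

lemma exists_unitary_piF_eq_gMap (x : Circle × E3) :
    ∃ W ∈ Matrix.unitaryGroup (Fin 2) ℂ, piF W = gMap x := by
  obtain ⟨ζ, y, hy⟩ := x
  have hy1 : y 0 ^ 2 + y 1 ^ 2 + y 2 ^ 2 ≤ 1 := by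
    rw [← norm_sq_E3]
    exact pow_le_one₀ (norm_nonneg _) (by simpa using hy)
  -- Only the real part of `β` is visible to `piF`, so its imaginary part is free to complete a unit
  -- vector.
  let t : ℝ := √(1 - (y 0 ^ 2 + y 1 ^ 2 + y 2 ^ 2))
  have ht : t ^ 2 = 1 - (y 0 ^ 2 + y 1 ^ 2 + y 2 ^ 2) := Real.sq_sqrt (by linarith)
  let α : ℂ := ⟨y 1, y 2⟩
  let β : ℂ := ⟨y 0, t⟩
  have hαβ : ‖α‖ ^ 2 + ‖β‖ ^ 2 = 1 := by
    simp only [Complex.sq_norm, Complex.normSq_apply, α, β]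
    linear_combination ht
  have hζ : ‖(ζ : ℂ)‖ = 1 := Circle.norm_coe ζ
  refine ⟨!![ζ * α, ζ * β; ζ * star β, -ζ * star α], ?_, ?_⟩
  · rw [mem_unitaryGroup_two_iff]
    refine ⟨?_, ?_, ?_⟩
    · simp only [star_mul', star_star]; ring
    · simpa [hζ] using hαβ
    · simpa [hζ, add_comm] using hαβ
  · have hc : star α * α + star β * β = 1 := by
      rw [star_mul_self_re, star_mul_self_re, ← Complex.ofReal_add, hαβ, Complex.ofReal_one]
    have hα : α = y 1 + Complex.I * y 2 := by
      apply Complex.ext <;> simp [α]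
    have hα' : star α = y 1 - Complex.I * y 2 := by
      apply Complex.ext <;> simp [α]
    have hβ : β + star β = 2 * y 0 := by
      apply Complex.ext <;> simp [β]; ring
    ext i
    fin_cases i
    · simp [piF, gMap, hα]
    · simp only [piF, gMap, ← hα']; simp
    · simp only [piF, gMap, Matrix.det_fin_two_of]
      simp only [Fin.reduceFinMk, Matrix.cons_val]
      linear_combination -(ζ : ℂ) ^ 2 * hc
    · simp only [piF, gMap]
      simp
      simp only [Complex.star_def] at hβ
      linear_combination (ζ : ℂ) * hβ

lemma piF_mem_range_gMap {U : Matrix (Fin 2) (Fin 2) ℂ}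
    (hU : U ∈ Matrix.unitaryGroup (Fin 2) ℂ) : piF U ∈ Set.range gMap := by
  have hdetu : star U.det * U.det = 1 := Unitary.star_mul_self_of_mem
    (Matrix.det_of_mem_unitary hU)
  rw [U.eta_fin_two] at hU hdetu ⊢
  obtain ⟨h, h1, h2⟩ := (mem_unitaryGroup_two_iff _ _ _ _).1 hU
  generalize U 0 0 = a at *
  generalize U 0 1 = b at *
  generalize U 1 0 = c at *
  generalize U 1 1 = d at *
  rw [Matrix.det_fin_two_of] at hdetu
  -- The third coordinate of `gMap` forces `ζ ^ 2 = -det U`.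
  obtain ⟨z, hz⟩ := IsAlgClosed.exists_pow_nat_eq (-(a * d - b * c)) two_pos
  have hz1 : ‖z‖ = 1 := by
    have : ‖a * d - b * c‖ ^ 2 = 1 := by
      rw [star_mul_self_re] at hdetu; exact_mod_cast hdetu
    have h2 : ‖z‖ ^ 2 = ‖a * d - b * c‖ := by rw [← norm_pow, hz, norm_neg]
    have h3 : (‖z‖ ^ 2) ^ 2 = 1 := by rw [h2, this]
    rw [← pow_mul] at h3
    exact (pow_eq_one_iff_of_nonneg (norm_nonneg _) (by norm_num)).1 h3
  have hzz : star z * z = 1 := by rw [star_mul_self_re, hz1]; simp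
  have e1 : star a * a + star c * c = 1 := by
    rw [star_mul_self_re, star_mul_self_re, ← Complex.ofReal_add, h1, Complex.ofReal_one]
  have e2 : star b * b + star d * d = 1 := by
    rw [star_mul_self_re, star_mul_self_re, ← Complex.ofReal_add, h2, Complex.ofReal_one]
  have h' : star b * a + star d * c = 0 := by
    simpa [mul_comm] using congrArg star h
  -- A unitary is determined by its first row and its determinant.
  have hd : d = -z ^ 2 * star a := by
    rw [hz]; linear_combination -d * e1 + c * h
  have hc : c = z ^ 2 * star b := by
    rw [hz]; linear_combination -c * e2 + d * h'
  have hab : ‖a‖ ^ 2 + ‖b‖ ^ 2 = 1 := by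
    rw [← h1, hc, norm_mul, norm_pow, hz1, norm_star]; ring
  let y : EuclideanSpace ℝ (Fin 3) := !₂[(star z * b).re, (star z * a).re, (star z * a).im]
  have hy : y ∈ Metric.closedBall (0 : EuclideanSpace ℝ (Fin 3)) 1 := by
    rw [mem_closedBall_zero_iff]
    refine le_of_sq_le_sq ?_ zero_le_one
    rw [norm_sq_E3]
    have f1 : ‖star z * a‖ ^ 2 = ‖a‖ ^ 2 := by rw [norm_mul, norm_star, hz1, one_mul]
    have f2 : ‖star z * b‖ ^ 2 = ‖b‖ ^ 2 := by rw [norm_mul, norm_star, hz1, one_mul]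
    rw [Complex.sq_norm, Complex.normSq_apply] at f1 f2
    simp only [y, Matrix.cons_val]
    nlinarith [sq_nonneg (star z * b).im]
  refine ⟨(⟨z, by simpa [Submonoid.unitSphere] using hz1⟩, ⟨y, hy⟩), ?_⟩
  have g1 : ((y 1 : ℝ) : ℂ) + Complex.I * ((y 2 : ℝ) : ℂ) = star z * a := by
    apply Complex.ext <;> simp [y]
  have g2 : ((y 1 : ℝ) : ℂ) - Complex.I * ((y 2 : ℝ) : ℂ) = z * star a := by
    apply Complex.ext <;> simp [y] ; ring
  have g3 : 2 * ((y 0 : ℝ) : ℂ) = star z * b + z * star b := by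
    apply Complex.ext <;> simp [y] <;> ring
  unfold gMap piF
  rw [Matrix.det_fin_two_of]
  simp only [g1, g2]
  ext i
  fin_cases i
  · simp only [Fin.zero_eta, Matrix.cons_val, Matrix.of_apply]
    linear_combination a * hzz
  · simp only [Fin.mk_one, Matrix.cons_val, Matrix.of_apply]
    rw [hd]; ring
  · simp only [Fin.reduceFinMk, Matrix.cons_val]
    linear_combination -hz
  · simp only [Fin.reduceFinMk, Matrix.cons_val, Matrix.of_apply]
    linear_combination z * g3 + b * hzz - hc

/-! ### Peak functions and minimality -/

/-- The power sums `u ^ n + v ^ n` as polynomials in `u + v` and `u * v`. -/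
def powerSum {R : Type*} [CommRing R] (s p : R) : ℕ → R
  | 0 => 2
  | 1 => s
  | n + 2 => s * powerSum s p (n + 1) - p * powerSum s p n

lemma powerSum_add_mul {R : Type*} [CommRing R] (u v : R) (n : ℕ) :
    powerSum (u + v) (u * v) n = u ^ n + v ^ n := by
  induction n using Nat.twoStepInduction with
  | zero => simp [powerSum]; norm_num
  | one => simp [powerSum]
  | more n h1 h2 => rw [powerSum, h1, h2]; ring

lemma differentiable_powerSum {E : Type*} [NormedAddCommGroup E] [NormedSpace ℂ E] {s p : E → ℂ}
    (hs : Differentiable ℂ s) (hp : Differentiable ℂ p) (n : ℕ) :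
    Differentiable ℂ fun x => powerSum (s x) (p x) n := by
  induction n using Nat.twoStepInduction with
  | zero => simp [powerSum]
  | one => simpa [powerSum] using hs
  | more n h1 h2 => exact (hs.fun_mul h2).fun_sub (hp.fun_mul h1)

/-- The affine function `(1 + tr (W* A) / 2) / 2`, which peaks at `W` among contractions if `W` is
unitary. -/
noncomputable def peakFunction (W A : Matrix (Fin 2) (Fin 2) ℂ) : ℂ :=
  (1 + (star (W 0 0) * A 0 0 + star (W 1 0) * A 1 0 +
    (star (W 0 1) * A 0 1 + star (W 1 1) * A 1 1)) / 2) / 2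

lemma continuous_peakFunction (W : Matrix (Fin 2) (Fin 2) ℂ) : Continuous (peakFunction W) := by
  unfold peakFunction; fun_prop

lemma peakFunction_self {W : Matrix (Fin 2) (Fin 2) ℂ}
    (hW : W ∈ Matrix.unitaryGroup (Fin 2) ℂ) : peakFunction W W = 1 := by
  rw [W.eta_fin_two] at hW
  obtain ⟨-, h1, h2⟩ := (mem_unitaryGroup_two_iff _ _ _ _).1 hW
  unfold peakFunction
  rw [star_mul_self_re, star_mul_self_re, star_mul_self_re, star_mul_self_re,
    ← Complex.ofReal_add, ← Complex.ofReal_add, h1, h2]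
  norm_num

/-- Equality case of Cauchy–Schwarz in the Frobenius norm: modulus at least one forces `2 ≤ Re tr
(W* A)`, hence `A = W`. The summand 1 in the peak function excludes other unimodular multiples of
`W`; the Frobenius bound passes to transposes. -/
lemma norm_peakFunction_lt {W A : Matrix (Fin 2) (Fin 2) ℂ}
    (hW : W ∈ Matrix.unitaryGroup (Fin 2) ℂ)
    (hA : ‖A 0 0‖ ^ 2 + ‖A 1 0‖ ^ 2 + (‖A 0 1‖ ^ 2 + ‖A 1 1‖ ^ 2) ≤ 2) (hne : A ≠ W) :
    ‖peakFunction W A‖ < 1 := by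
  have hW' := hW
  rw [W.eta_fin_two] at hW'
  obtain ⟨-, h1, h2⟩ := (mem_unitaryGroup_two_iff _ _ _ _).1 hW'
  contrapose! hne
  unfold peakFunction at hne
  set S := star (W 0 0) * A 0 0 + star (W 1 0) * A 1 0 +
    (star (W 0 1) * A 0 1 + star (W 1 1) * A 1 1) with hS
  have hS2 : ‖S‖ ≤ 2 := by
    have hmul : ∀ w a : ℂ, ‖star w * a‖ ≤ (‖w‖ ^ 2 + ‖a‖ ^ 2) / 2 := by
      intro w a
      rw [norm_mul, norm_star]
      linarith [sq_nonneg (‖w‖ - ‖a‖)]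
    have ha := norm_add_le (star (W 0 0) * A 0 0 + star (W 1 0) * A 1 0)
      (star (W 0 1) * A 0 1 + star (W 1 1) * A 1 1)
    have hb := norm_add_le (star (W 0 0) * A 0 0) (star (W 1 0) * A 1 0)
    have hc := norm_add_le (star (W 0 1) * A 0 1) (star (W 1 1) * A 1 1)
    linarith [hmul (W 0 0) (A 0 0), hmul (W 1 0) (A 1 0), hmul (W 0 1) (A 0 1),
      hmul (W 1 1) (A 1 1)]
  have hre : 2 ≤ S.re := by
    have hS4 : ‖S‖ ^ 2 ≤ 4 := by nlinarith [norm_nonneg S]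
    have hge : 1 ≤ ‖(1 + S / 2) / 2‖ ^ 2 := one_le_pow₀ hne
    have e : ‖(1 + S / 2) / 2‖ ^ 2 = (4 + 4 * S.re + ‖S‖ ^ 2) / 16 := by
      have : (1 + S / 2) / 2 = ((1 / 4 : ℝ) : ℂ) * (2 + S) := by push_cast; ring
      rw [this, norm_mul, mul_pow, Complex.norm_real, Complex.sq_norm, Complex.sq_norm,
        Complex.normSq_apply, Complex.normSq_apply]
      norm_num
      ring
    linarith
  have hdist : ∀ w a : ℂ, ‖a - w‖ ^ 2 = ‖a‖ ^ 2 + ‖w‖ ^ 2 - 2 * (star w * a).re := by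
    intro w a
    simp only [Complex.sq_norm, Complex.normSq_apply, Complex.sub_re, Complex.sub_im,
      Complex.mul_re, Complex.star_def, Complex.conj_re, Complex.conj_im]
    ring
  have hsum : ‖A 0 0 - W 0 0‖ ^ 2 + ‖A 1 0 - W 1 0‖ ^ 2 +
      (‖A 0 1 - W 0 1‖ ^ 2 + ‖A 1 1 - W 1 1‖ ^ 2) ≤ 0 := by
    rw [hdist, hdist, hdist, hdist]
    have := congrArg Complex.re hS
    simp only [Complex.add_re] at this
    linarith
  have hz : ∀ i j, ‖A i j - W i j‖ ^ 2 ≤ 0 := by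
    intro i j
    fin_cases i <;> fin_cases j <;> simp only [Fin.zero_eta, Fin.mk_one] <;>
      linarith [sq_nonneg ‖A 0 0 - W 0 0‖, sq_nonneg ‖A 1 0 - W 1 0‖,
        sq_nonneg ‖A 0 1 - W 0 1‖, sq_nonneg ‖A 1 1 - W 1 1‖]
  ext i j
  have := hz i j
  rw [← sub_eq_zero, ← norm_eq_zero]
  exact pow_eq_zero_iff two_ne_zero |>.1 (le_antisymm this (sq_nonneg _))

/-- The sum of the `n`-th powers of the values at `A` and `Aᵀ` of the peak function at `W`, as a
polynomial in `piF A`. -/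
noncomputable def symmetricPeak (W : Matrix (Fin 2) (Fin 2) ℂ) (n : ℕ) (x : Fin 4 → ℂ) : ℂ :=
  let α : ℂ := 1 / 2 + (star (W 0 0) * x 0 + star (W 1 1) * x 1) / 4
  let β : ℂ := star (W 0 1) / 4
  let γ : ℂ := star (W 1 0) / 4
  powerSum (2 * α + (β + γ) * x 3)
    (α ^ 2 + α * (β + γ) * x 3 + β * γ * x 3 ^ 2 + (β - γ) ^ 2 * (x 0 * x 1 - x 2)) n

/-- Transposition swaps `a₁₂` and `a₂₁`, whose sum is `x 3` and whose product is `x 0 * x 1 - x 2`.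
-/
lemma symmetricPeak_piF (W A : Matrix (Fin 2) (Fin 2) ℂ) (n : ℕ) :
    symmetricPeak W n (piF A) = peakFunction W A ^ n + peakFunction W A.transpose ^ n := by
  rw [← powerSum_add_mul]
  simp only [symmetricPeak, piF, peakFunction, Matrix.transpose_apply, Matrix.det_fin_two,
    Matrix.cons_val]
  congr 1 <;> ring

lemma differentiable_symmetricPeak (W : Matrix (Fin 2) (Fin 2) ℂ) (n : ℕ) :
    Differentiable ℂ (symmetricPeak W n) := by
  unfold symmetricPeak
  refine differentiable_powerSum ?_ ?_ n <;> fun_prop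

lemma piF_transpose (A : Matrix (Fin 2) (Fin 2) ℂ) : piF A.transpose = piF A := by
  simp [piF, add_comm]

/-- The image of a unitary matrix lies in every closed boundary. -/
lemma piF_mem_of_isClosedBoundary {K : Set (Fin 4 → ℂ)} (hK : IsClosedBoundary domainF K)
    {W : Matrix (Fin 2) (Fin 2) ℂ} (hW : W ∈ Matrix.unitaryGroup (Fin 2) ℂ) : piF W ∈ K := by
  obtain ⟨hclosed, hsub, hmax⟩ := hK
  by_contra hWK
  let C := {A | IsContractionMatrix A} ∩ piF ⁻¹' K
  have hC : IsCompact C :=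
    isCompact_setOf_isContractionMatrix.inter_right (hclosed.preimage continuous_piF)
  have hfrob : ∀ {A}, IsContractionMatrix A →
      ‖A 0 0‖ ^ 2 + ‖A 1 0‖ ^ 2 + (‖A 0 1‖ ^ 2 + ‖A 1 1‖ ^ 2) ≤ 2 := by
    intro A hA
    linarith [hA.col_zero, hA.col_one]
  have hfrobT : ∀ {A}, IsContractionMatrix A →
      ‖A.transpose 0 0‖ ^ 2 + ‖A.transpose 1 0‖ ^ 2 +
        (‖A.transpose 0 1‖ ^ 2 + ‖A.transpose 1 1‖ ^ 2) ≤ 2 := by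
    intro A hA
    simp only [Matrix.transpose_apply]
    linarith [hA.col_zero, hA.col_one]
  have hlift : ∀ x ∈ K, ∃ A ∈ C, piF A = x := by
    intro x hx
    obtain ⟨A, hA, rfl⟩ := closure_domainF ▸ hsub hx
    exact ⟨A, ⟨hA, hx⟩, rfl⟩
  have hCne : C.Nonempty := by
    obtain ⟨x, hx, -⟩ := hmax 0 (differentiable_const 0).diffContOnCl
    obtain ⟨A, hA, -⟩ := hlift x hx
    exact ⟨A, hA⟩
  obtain ⟨A₀, hA₀, hA₀max⟩ := hC.exists_isMaxOn hCne
    (f := fun A => max ‖peakFunction W A‖ ‖peakFunction W A.transpose‖)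
    ((continuous_peakFunction W).norm.max
      ((continuous_peakFunction W).comp continuous_id.matrix_transpose).norm).continuousOn
  set ρ := max ‖peakFunction W A₀‖ ‖peakFunction W A₀.transpose‖ with hρ
  have hρ0 : 0 ≤ ρ := (norm_nonneg _).trans (le_max_left _ _)
  have hρ1 : ρ < 1 := by
    refine max_lt (norm_peakFunction_lt hW (hfrob hA₀.1) ?_)
      (norm_peakFunction_lt hW (hfrobT hA₀.1) ?_)
    · rintro rfl
      exact hWK hA₀.2
    · intro h
      apply hWK
      rw [← h, piF_transpose]
      exact hA₀.2
  have hcontra : ∀ n, ‖1 + peakFunction W W.transpose ^ n‖ ≤ 2 * ρ ^ n := by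
    intro n
    obtain ⟨x, hx, hxmax⟩ := hmax _ (differentiable_symmetricPeak W n).diffContOnCl
    obtain ⟨A, hA, rfl⟩ := hlift x hx
    have hWcl : piF W ∈ closure domainF := by
      rw [closure_domainF]
      exact ⟨W, isContractionMatrix_of_mem_unitaryGroup hW, rfl⟩
    have h := hxmax _ hWcl
    rw [symmetricPeak_piF, symmetricPeak_piF, peakFunction_self hW, one_pow] at h
    have hAρ : max ‖peakFunction W A‖ ‖peakFunction W A.transpose‖ ≤ ρ := hA₀max hA
    have ha := pow_le_pow_left₀ (norm_nonneg _) ((le_max_left _ _).trans hAρ) n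
    have hb := pow_le_pow_left₀ (norm_nonneg _) ((le_max_right _ _).trans hAρ) n
    refine h.trans ((norm_add_le _ _).trans ?_)
    rw [norm_pow, norm_pow]
    linarith
  have hlim : Filter.Tendsto (fun n : ℕ => 2 * ρ ^ n) Filter.atTop (nhds 0) := by
    simpa using (tendsto_pow_atTop_nhds_zero_of_lt_one hρ0 hρ1).const_mul 2
  -- The left side of `hcontra` is constantly 2 for symmetric `W` and otherwise tends to 1, while
  -- the right side tends to 0.
  by_cases hWT : W.transpose = W
  · simp only [hWT, peakFunction_self hW, one_pow] at hcontra
    have := ge_of_tendsto' hlim hcontra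
    norm_num at this
  · have hs := norm_peakFunction_lt hW (hfrobT (isContractionMatrix_of_mem_unitaryGroup hW)) hWT
    have hlim' := ((tendsto_pow_atTop_nhds_zero_of_norm_lt_one hs).const_add 1).norm
    have := le_of_tendsto_of_tendsto' hlim' hlim hcontra
    norm_num at this

/-! ### The Shilov boundary and its topology -/

lemma isLeast_range_gMap :
    IsLeast {K | IsClosedBoundary domainF K} (Set.range gMap) := by
  refine ⟨⟨(isCompact_range continuous_gMap).isClosed, ?_, ?_⟩, ?_⟩
  · rintro _ ⟨x, rfl⟩
    obtain ⟨W, hW, hWx⟩ := exists_unitary_piF_eq_gMap x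
    rw [closure_domainF]
    exact ⟨W, isContractionMatrix_of_mem_unitaryGroup hW, hWx⟩
  · intro f hf
    have hcpt : IsCompact (closure domainF) := by
      rw [closure_domainF]
      exact isCompact_setOf_isContractionMatrix.image continuous_piF
    have hne : (closure domainF).Nonempty := by
      rw [closure_domainF]
      exact ⟨_, 1, isContractionMatrix_of_mem_unitaryGroup (one_mem _), rfl⟩
    obtain ⟨x, hx, hxmax⟩ := hcpt.exists_isMaxOn hne hf.continuousOn.norm
    rw [closure_domainF] at hx
    obtain ⟨A, hA, rfl⟩ := hx
    obtain ⟨U, hU, hAU⟩ := exists_unitary_norm_le hf hA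
    exact ⟨_, piF_mem_range_gMap hU, fun y hy => (hxmax hy).trans hAU⟩
  · rintro K hK _ ⟨x, rfl⟩
    obtain ⟨W, hW, hWx⟩ := exists_unitary_piF_eq_gMap x
    exact hWx ▸ piF_mem_of_isClosedBoundary hK hW

lemma shilovBoundary_domainF : shilovBoundary domainF = Set.range gMap :=
  subset_antisymm (Set.sInter_subset_of_mem isLeast_range_gMap.1)
    (Set.subset_sInter fun _ hK => isLeast_range_gMap.2 hK)

lemma gMap_neg (ζ : Circle) (y : E3) : gMap (-ζ, -y) = gMap (ζ, y) := by
  ext i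
  fin_cases i <;> simp [gMap] <;> ring

lemma eq_of_gMap_eq {ζ : Circle} {y z : E3} (h : gMap (ζ, y) = gMap (ζ, z)) : y = z := by
  have hζ : (ζ : ℂ) ≠ 0 := ζ.coe_ne_zero
  have h0 := congrFun h 0
  have h3 := congrFun h 3
  simp only [gMap, Matrix.cons_val] at h0 h3
  have h0' := mul_left_cancel₀ hζ h0
  have h3' := mul_left_cancel₀ (mul_ne_zero two_ne_zero hζ) h3
  have hre := congrArg Complex.re h0'
  have him := congrArg Complex.im h0'
  simp at hre him
  ext i
  fin_cases i
  · exact_mod_cast h3'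
  · exact hre
  · exact him

/-- The coordinate `-ζ ^ 2` fixes `ζ` up to sign, and the antipodal symmetry absorbs the sign. -/
lemma gSetoid_iff (ζ η : Circle) (y z : E3) :
    gSetoid (ζ, y) (η, z) ↔ ((ζ, y) = (η, z) ∨ (ζ, y) = (-η, -z)) := by
  change gMap (ζ, y) = gMap (η, z) ↔ _
  constructor
  · intro h
    have h2 := congrFun h 2
    simp only [gMap, Matrix.cons_val, neg_inj] at h2
    rcases sq_eq_sq_iff_eq_or_eq_neg.1 h2 with h2 | h2
    · obtain rfl : ζ = η := Circle.ext h2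
      rw [eq_of_gMap_eq h]
      exact Or.inl rfl
    · obtain rfl : ζ = -η := Circle.ext (by simpa using h2)
      rw [← gMap_neg η z] at h
      rw [eq_of_gMap_eq h]
      exact Or.inr rfl
  · rintro (h | h)
    · rw [h]
    · rw [h, gMap_neg]

lemma nonempty_homeomorph_range_gMap : Nonempty (Set.range gMap ≃ₜ Quotient gSetoid) := by
  let e : Quotient gSetoid ≃ Set.range gMap := Setoid.quotientKerEquivRange gMap
  have he : Continuous e := by
    refine continuous_induced_rng.2 (continuous_quot_lift _ continuous_gMap)
  exact ⟨he.homeoOfEquivCompactToT2.symm⟩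

theorem mainTheorem12 :
    -- the Shilov boundary exists, i.e. there is a smallest closed boundary
    IsLeast {K | IsClosedBoundary domainF K} (shilovBoundary domainF) ∧
    -- the equivalence relation is the antipodal identification
    (∀ (ζ η : Circle) (y z : E3),
      gSetoid (ζ, y) (η, z) ↔ ((ζ, y) = (η, z) ∨ (ζ, y) = (-η, -z))) ∧
    -- the Shilov boundary is homeomorphic to the quotient
    Nonempty (shilovBoundary domainF ≃ₜ Quotient gSetoid) := by
  rw [shilovBoundary_domainF]
  exact ⟨isLeast_range_gMap, gSetoid_iff, nonempty_homeomorph_range_gMap⟩
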